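/- **Proposition (Oracle Profiled Gradient).** Let $\Theta\subseteq\mathbb{R}^p$, and for every $\theta$ let $\mathcal{U}_{\theta,1}\subseteq\mathbb{R}^d$. Let $s_\theta$ be the gauge (Minkowski functional) of $\mathcal{U}_{\theta,1}$ and $\mathcal{U}_{\theta,\rho}=\{u: s_\theta(u)\le\rho\}$; write $\sigma_C(w)=\sup_{u\in C}\langle w,u\rangle$. Let $\mathcal{X}\subseteq\mathbb{R}^{n}$ be closed and convex, $f:\mathbb{R}^{n}\to\mathbb{R}\cup\{+\infty\}$ convex, $a_1,\dots,a_m:\mathbb{R}^{n}\to\mathbb{R}$ convex, $w_1,\dots,w_m\in\mathbb{R}^d$, $b_1,\dots,b_m\in\mathbb{R}$, and $$V(\theta,\rho)=\inf\{f(x): x\in\mathcal{X},\ a_j(x)+\sigma_{\mathcal{U}_{\theta,\rho}}(w_j)\le b_j\ (j=1,\dots,m)\}\in[-\infty,+\infty],\qquad \inf\emptyset=+\infty.$$ Let $\mathcal{M}^*(\theta,\rho)$ be the set of maximizers over $\mu\in\mathbb{R}^m_{\ge0}$ of the Lagrange dual function $q(\mu;\theta,\rho)=\inf_{x\in\mathcal{X}}\bigl(f(x)+\sum_{j}\mu_j(a_j(x)+\sigma_{\mathcal{U}_{\theta,\rho}}(w_j)-b_j)\bigr)$.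 Let $U\sim P$ be a random vector in $\mathbb{R}^d$, $\tau\in(0,1)$, $F_\theta(r)=\mathbb{P}(s_\theta(U)\le r)$, $\rho_P(\theta)=\inf\{r>0: F_\theta(r)\ge\tau\}$ and $J_P(\theta)=V(\theta,\rho_P(\theta))$. Fix $\theta$ in the interior of $\Theta$ and assume: 1. (Gauge regularity) for every $\theta'\in\Theta$, $\mathcal{U}_{\theta',1}$ is nonempty, convex, compact, and contains $0$ in its interior; 2. (Slater at $(\theta,\rho_P(\theta))$) $V(\theta,\rho_P(\theta))<+\infty$, $f$ is bounded below on $\mathcal{X}$, and some $\bar x$ in the relative interior of $\mathcal{X}$ satisfies $f(\bar x)<+\infty$ and $a_j(\bar x)+\sigma_{\mathcal{U}_{\theta,\rho_P(\theta)}}(w_j)<b_j$ for all $j$; 3. (Support smoothness) for all $j$ and $\rho>0$, the map $\theta'\mapsto\sigma_{\mathcal{U}_{\theta',\rho}}(w_j)$ is continuously differentiable on the interior of $\Theta$; 4. (Quantile regularity) $F_\theta$ is $C^1$ near $\rho_P(\theta)$, its derivative $f_\theta$ satisfies $f_\theta(\rho_P(\theta))>0$, and $(\theta',r)\mapsto F_{\theta'}(r)$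 is $C^1$ near $(\theta,\rho_P(\theta))$; 5. $V$ is differentiable at $(\theta,\rho_P(\theta))$. Then $J_P$ is finite near $\theta$, $\rho_P$ is differentiable at $\theta$ with $$\nabla\rho_P(\theta)=-\frac{\nabla_\theta F_\theta(r)\big|_{r=\rho_P(\theta)}}{f_\theta(\rho_P(\theta))},$$ $\mathcal{M}^*(\theta,\rho_P(\theta))\neq\emptyset$, and for every $\mu^*\in\mathcal{M}^*(\theta,\rho_P(\theta))$ the function $J_P$ is differentiable at $\theta$ with $$\nabla J_P(\theta)=\sum_{j=1}^m\mu_j^*\,\nabla_\theta\sigma_{\mathcal{U}_{\theta,\rho}}(w_j)\Big|_{\rho=\rho_P(\theta)}+\Bigl(\sum_{j=1}^m\mu_j^*\,\sigma_{\mathcal{U}_{\theta,1}}(w_j)\Bigr)\nabla\rho_P(\theta).$$ -/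

import Mathlib

open Set Filter Topology MeasureTheory

noncomputable section

namespace RobustProfile

/-- Score of the shape `θ`: the gauge (Minkowski functional) of the unit set `𝒰_{θ,1} = unit θ`. -/
def score {p d : ℕ} (unit : EuclideanSpace ℝ (Fin p) → Set (EuclideanSpace ℝ (Fin d)))
    (θ : EuclideanSpace ℝ (Fin p)) (u : EuclideanSpace ℝ (Fin d)) : ℝ :=
  gauge (unit θ) u

/-- The uncertainty set `𝒰_{θ,ρ} = {u | s_θ(u) ≤ ρ}`. -/
def uncertaintySet {p d : ℕ} (unit : EuclideanSpace ℝ (Fin p) → Set (EuclideanSpace ℝ (Fin d)))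
    (θ : EuclideanSpace ℝ (Fin p)) (ρ : ℝ) : Set (EuclideanSpace ℝ (Fin d)) :=
  {u | score unit θ u ≤ ρ}

/-- Gauge regularity on the parameter set `Θ`. -/
def GaugeRegular {p d : ℕ} (unit : EuclideanSpace ℝ (Fin p) → Set (EuclideanSpace ℝ (Fin d)))
    (Θ : Set (EuclideanSpace ℝ (Fin p))) : Prop :=
  ∀ θ ∈ Θ, (unit θ).Nonempty ∧ Convex ℝ (unit θ) ∧ IsCompact (unit θ) ∧ 0 ∈ interior (unit θ)

/-- Support function `σ_C(w) = sup_{u ∈ C} ⟨w, u⟩`, a real number when `C` is nonempty and bounded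
(which all the sets `𝒰_{θ,ρ}`, `ρ ≥ 0`, are under gauge regularity). -/
def supportFun {d : ℕ} (C : Set (EuclideanSpace ℝ (Fin d))) (w : EuclideanSpace ℝ (Fin d)) : ℝ :=
  sSup ((fun u => inner ℝ w u) '' C)

/-- The map `(θ, ρ) ↦ σ_{𝒰_{θ,ρ}}(w)`. -/
def exposure {p d : ℕ} (unit : EuclideanSpace ℝ (Fin p) → Set (EuclideanSpace ℝ (Fin d)))
    (w : EuclideanSpace ℝ (Fin d)) (θ : EuclideanSpace ℝ (Fin p)) (ρ : ℝ) : ℝ :=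
  supportFun (uncertaintySet unit θ ρ) w

/-- Data of the robust dispatch problem
`inf_{x ∈ X} f x` subject to `a_j x + σ_{𝒰_{θ,ρ}}(w_j) ≤ b_j`, `j = 1, …, m`:
`X` is a closed convex set, `f : ℝⁿ → ℝ ∪ {+∞}` is convex (its epigraph is convex), the `a_j` are
real-valued convex functions. -/
structure Dispatch (n d m : ℕ) where
  X : Set (EuclideanSpace ℝ (Fin n))
  f : EuclideanSpace ℝ (Fin n) → EReal
  a : Fin m → EuclideanSpace ℝ (Fin n) → ℝ
  w : Fin m → EuclideanSpace ℝ (Fin d)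
  b : Fin m → ℝ
  isClosed_X : IsClosed X
  convex_X : Convex ℝ X
  f_ne_bot : ∀ x, f x ≠ ⊥
  convex_f : Convex ℝ {z : EuclideanSpace ℝ (Fin n) × ℝ | f z.1 ≤ (z.2 : EReal)}
  convex_a : ∀ j, ConvexOn ℝ univ (a j)

namespace Dispatch

/-- The feasible set at `(θ, ρ)`. -/
def feasible {n p d m : ℕ} (D : Dispatch n d m)
    (unit : EuclideanSpace ℝ (Fin p) → Set (EuclideanSpace ℝ (Fin d)))
    (θ : EuclideanSpace ℝ (Fin p)) (ρ : ℝ) : Set (EuclideanSpace ℝ (Fin n)) :=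
  {x | x ∈ D.X ∧ ∀ j, D.a j x + exposure unit (D.w j) θ ρ ≤ D.b j}

/-- The value function `V(θ, ρ)`; it is `+∞` if the feasible set is empty. -/
def value {n p d m : ℕ} (D : Dispatch n d m)
    (unit : EuclideanSpace ℝ (Fin p) → Set (EuclideanSpace ℝ (Fin d)))
    (θ : EuclideanSpace ℝ (Fin p)) (ρ : ℝ) : EReal :=
  ⨅ x ∈ D.feasible unit θ ρ, D.f x

/-- The local Slater condition at `(θ, ρ)`; `intrinsicInterior ℝ X` is the relative interior. -/
def Slater {n p d m : ℕ} (D : Dispatch n d m)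
    (unit : EuclideanSpace ℝ (Fin p) → Set (EuclideanSpace ℝ (Fin d)))
    (θ : EuclideanSpace ℝ (Fin p)) (ρ : ℝ) : Prop :=
  D.value unit θ ρ < ⊤ ∧
  (∃ c : ℝ, ∀ x ∈ D.X, (c : EReal) ≤ D.f x) ∧
  ∃ x ∈ intrinsicInterior ℝ D.X, D.f x < ⊤ ∧
    ∀ j, D.a j x + exposure unit (D.w j) θ ρ < D.b j

/-- The Lagrange dual function
`q(μ; θ, ρ) = inf_{x ∈ X} f x + ∑_j μ_j (a_j x + σ_{𝒰_{θ,ρ}}(w_j) - b_j)`. -/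
def dualFun {n p d m : ℕ} (D : Dispatch n d m)
    (unit : EuclideanSpace ℝ (Fin p) → Set (EuclideanSpace ℝ (Fin d)))
    (θ : EuclideanSpace ℝ (Fin p)) (ρ : ℝ) (μ : Fin m → ℝ) : EReal :=
  ⨅ x ∈ D.X,
    (D.f x + ((∑ j, μ j * (D.a j x + exposure unit (D.w j) θ ρ - D.b j) : ℝ) : EReal))

/-- The set `ℳ*(θ, ρ) = argmax_{μ ≥ 0} q(μ; θ, ρ)` of optimal dual multipliers. -/
def dualOptimizers {n p d m : ℕ} (D : Dispatch n d m)
    (unit : EuclideanSpace ℝ (Fin p) → Set (EuclideanSpace ℝ (Fin d)))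
    (θ : EuclideanSpace ℝ (Fin p)) (ρ : ℝ) : Set (Fin m → ℝ) :=
  {μ | 0 ≤ μ ∧ ∀ ν : Fin m → ℝ, 0 ≤ ν → D.dualFun unit θ ρ ν ≤ D.dualFun unit θ ρ μ}

/-- Support function smoothness. The gradient is taken at interior points of `Θ`; that it is locally
bounded there is part of continuous differentiability. -/
def SupportSmooth {n p d m : ℕ} (D : Dispatch n d m)
    (unit : EuclideanSpace ℝ (Fin p) → Set (EuclideanSpace ℝ (Fin d)))
    (Θ : Set (EuclideanSpace ℝ (Fin p))) : Prop :=
  ∀ j, ∀ ρ : ℝ, 0 < ρ → ContDiffOn ℝ 1 (fun θ => exposure unit (D.w j) θ ρ) (interior Θ)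

/-- Envelope shape gradient `g_θ(θ, ρ; μ) = ∑_j μ_j ∇_θ σ_{𝒰_{θ,ρ}}(w_j)`. -/
def shapeGrad {n p d m : ℕ} (D : Dispatch n d m)
    (unit : EuclideanSpace ℝ (Fin p) → Set (EuclideanSpace ℝ (Fin d)))
    (θ : EuclideanSpace ℝ (Fin p)) (ρ : ℝ) (μ : Fin m → ℝ) : EuclideanSpace ℝ (Fin p) :=
  ∑ j, μ j • gradient (fun θ' => exposure unit (D.w j) θ' ρ) θ

/-- Envelope radius derivative `g_ρ(θ, ρ; μ) = ∑_j μ_j σ_{𝒰_{θ,1}}(w_j)`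
(the expression does not involve `ρ` beyond the choice of `μ`). -/
def radiusGrad {n p d m : ℕ} (D : Dispatch n d m)
    (unit : EuclideanSpace ℝ (Fin p) → Set (EuclideanSpace ℝ (Fin d)))
    (θ : EuclideanSpace ℝ (Fin p)) (μ : Fin m → ℝ) : ℝ :=
  ∑ j, μ j * exposure unit (D.w j) θ 1

end Dispatch

/-- The score distribution function `F_θ(r) = ℙ(s_θ(U) ≤ r)`, `U ∼ P`. -/
def scoreCDF {p d : ℕ} (unit : EuclideanSpace ℝ (Fin p) → Set (EuclideanSpace ℝ (Fin d)))
    (P : Measure (EuclideanSpace ℝ (Fin d))) (θ : EuclideanSpace ℝ (Fin p)) (r : ℝ) : ℝ :=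
  P.real {u | score unit θ u ≤ r}

/-- The `τ`-quantile radius `ρ_P(θ) = inf {r > 0 | F_θ(r) ≥ τ}`. -/
def quantileRadius {p d : ℕ} (unit : EuclideanSpace ℝ (Fin p) → Set (EuclideanSpace ℝ (Fin d)))
    (P : Measure (EuclideanSpace ℝ (Fin d))) (τ : ℝ) (θ : EuclideanSpace ℝ (Fin p)) : ℝ :=
  sInf {r : ℝ | 0 < r ∧ τ ≤ scoreCDF unit P θ r}

/-- Quantile regularity at `θ`. The density `f_θ` is the derivative of `F_θ`. -/
def QuantileRegular {p d : ℕ} (unit : EuclideanSpace ℝ (Fin p) → Set (EuclideanSpace ℝ (Fin d)))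
    (P : Measure (EuclideanSpace ℝ (Fin d))) (τ : ℝ) (θ : EuclideanSpace ℝ (Fin p)) : Prop :=
  ContDiffAt ℝ 1 (scoreCDF unit P θ) (quantileRadius unit P τ θ) ∧
  0 < deriv (scoreCDF unit P θ) (quantileRadius unit P τ θ) ∧
  ContDiffAt ℝ 1 (fun z : EuclideanSpace ℝ (Fin p) × ℝ => scoreCDF unit P z.1 z.2)
    (θ, quantileRadius unit P τ θ)

/-- The profiled objective `J_P(θ) = V(θ, ρ_P(θ))`. -/
def profiled {n p d m : ℕ} (D : Dispatch n d m)
    (unit : EuclideanSpace ℝ (Fin p) → Set (EuclideanSpace ℝ (Fin d)))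
    (P : Measure (EuclideanSpace ℝ (Fin d))) (τ : ℝ) (θ : EuclideanSpace ℝ (Fin p)) : EReal :=
  D.value unit θ (quantileRadius unit P τ θ)

end RobustProfile

end

/-! This is an envelope argument. The parameters enter the Lagrangian only through the exposures,
and linearly, so an optimal multiplier gives a lower bound for the value at every parameter that is
affine in the exposures (`Slater.toReal_value_add_le`) and tight at `(θ, ρ_P(θ))`. Hence `J_P - ∑
μ_j σ_j`, taken along the quantile radius, has a local minimum at `θ`. Both terms are
differentiable, so their gradients agree. Strong duality comes from separating a point from an open
convex set (`exists_multiplier`), the derivative of `ρ_P` from squeezing the quantile between two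
nearby radii, and that of the exposures from homogeneity in the radius. -/

namespace RobustProfile

/-! ### Lagrange multipliers by separation. -/

section Duality

variable {E ι : Type*}

/-- The strict upper image of `(g, f)` over `X`. -/
def strictImage (X : Set E) (f : E → EReal) (g : ι → E → ℝ) : Set ((ι → ℝ) × ℝ) :=
  {z | ∃ x ∈ X, f x < (z.2 : EReal) ∧ ∀ j, g j x < z.1 j}

/-- A union over `x` of open sets, so no continuity of `f` or `g` is needed. -/
lemma isOpen_strictImage [Finite ι] (X : Set E) (f : E → EReal) (g : ι → E → ℝ) :
    IsOpen (strictImage X f g) := by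
  have h : strictImage X f g =
      ⋃ x ∈ X, {z : (ι → ℝ) × ℝ | f x < (z.2 : EReal)} ∩ ⋂ j, {z | g j x < z.1 j} := by
    ext z; simp [strictImage, and_left_comm]
  rw [h]
  refine isOpen_biUnion fun x _ => IsOpen.inter ?_ (isOpen_iInter_of_finite fun j => ?_)
  · exact isOpen_Ioi.preimage (continuous_coe_real_ereal.comp continuous_snd)
  · exact isOpen_lt continuous_const ((continuous_apply j).comp continuous_fst)

variable [AddCommGroup E] [Module ℝ E]

lemma convex_strictImage {X : Set E} {f : E → EReal} {g : ι → E → ℝ} (hX : Convex ℝ X)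
    (hf : Convex ℝ {z : E × ℝ | f z.1 ≤ (z.2 : EReal)}) (hg : ∀ j, ConvexOn ℝ univ (g j)) :
    Convex ℝ (strictImage X f g) := by
  rintro ⟨u, t⟩ ⟨x, hx, hxt, hxu⟩ ⟨u', t'⟩ ⟨y, hy, hyt, hyu⟩ α β hα hβ hαβ
  have strict : ∀ {p q p' q' : ℝ}, p < q → p' < q' → α * p + β * p' < α * q + β * q' := by
    intro p q p' q' h h'
    rcases hα.eq_or_lt with h0 | h0
    · have : β = 1 := by linarith
      subst this; subst h0; linarith
    · have := mul_lt_mul_of_pos_left h h0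
      have := mul_le_mul_of_nonneg_left h'.le hβ
      linarith
  -- The epigraph only contains real heights, so one is inserted strictly above the possibly
  -- non-real `f x`.
  obtain ⟨s, hxs, hst⟩ := EReal.lt_iff_exists_real_btwn.1 hxt
  obtain ⟨s', hys, hst'⟩ := EReal.lt_iff_exists_real_btwn.1 hyt
  refine ⟨α • x + β • y, hX hx hy hα hβ hαβ, ?_, fun j => ?_⟩
  · have h1 := @hf (x, s) hxs.le (y, s') hys.le α β hα hβ hαβ
    refine lt_of_le_of_lt h1 ?_
    simpa using EReal.coe_lt_coe_iff.2
      (strict (EReal.coe_lt_coe_iff.1 hst) (EReal.coe_lt_coe_iff.1 hst'))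
  · refine ((hg j).2 (mem_univ x) (mem_univ y) hα hβ hαβ).trans_lt ?_
    simpa using strict (hxu j) (hyu j)

/-- Existence of Lagrange multipliers for a convex program under the Slater condition. -/
lemma exists_multiplier [Fintype ι] {X : Set E} {f : E → EReal} {g : ι → E → ℝ} (hX : Convex ℝ X)
    (hbot : ∀ x, f x ≠ ⊥)
    (hf : Convex ℝ {z : E × ℝ | f z.1 ≤ (z.2 : EReal)}) (hg : ∀ j, ConvexOn ℝ univ (g j))
    {v : ℝ} (hv : ∀ x ∈ X, (∀ j, g j x ≤ 0) → (v : EReal) ≤ f x)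
    (hslater : ∃ x ∈ X, f x < ⊤ ∧ ∀ j, g j x < 0) :
    ∃ μ : ι → ℝ, 0 ≤ μ ∧ ∀ x ∈ X, (v : EReal) ≤ f x + ((∑ j, μ j * g j x : ℝ) : EReal) := by
  classical
  have hnot : ((0 : ι → ℝ), v) ∉ strictImage X f g := by
    rintro ⟨x, hx, hxv, hxg⟩
    exact absurd (hv x hx fun j => (hxg j).le) (not_le.2 hxv)
  obtain ⟨φ, hφ⟩ := geometric_hahn_banach_open_point
    (convex_strictImage hX hf hg) (isOpen_strictImage X f g) hnot
  -- The image is closed under adding nonnegative vectors, which forces `φ ≤ 0` on the nonnegative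
  -- cone.
  have hup : ∀ z ∈ strictImage X f g, ∀ y : (ι → ℝ) × ℝ, 0 ≤ y → z + y ∈ strictImage X f g := by
    rintro z ⟨x, hx, hxz, hxg⟩ y hy
    refine ⟨x, hx, hxz.trans_le (EReal.coe_le_coe_iff.2 ?_), fun j => (hxg j).trans_le ?_⟩
    · exact le_add_of_nonneg_right hy.2
    · exact le_add_of_nonneg_right (hy.1 j)
  obtain ⟨x₀, hx₀, hfx₀, hgx₀⟩ := hslater
  obtain ⟨T, hT, -⟩ := EReal.lt_iff_exists_real_btwn.1 hfx₀
  have hmem : ((0 : ι → ℝ), T) ∈ strictImage X f g := ⟨x₀, hx₀, hT, hgx₀⟩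
  have hneg : ∀ y : (ι → ℝ) × ℝ, 0 ≤ y → φ y ≤ 0 := by
    intro y hy
    by_contra! hpos
    obtain ⟨k, hk⟩ := Archimedean.arch (φ (0, v) - φ (0, T)) hpos
    have := hφ _ (hup _ hmem (k • y) (nsmul_nonneg hy k))
    rw [map_add, map_nsmul] at this
    linarith
  have hdec : ∀ (u : ι → ℝ) (t : ℝ), φ (u, t) = ∑ j, u j * φ (Pi.single j 1, 0) + t * φ (0, 1) := by
    intro u t
    have h1 : (u, t) = ∑ j, u j • ((Pi.single j 1 : ι → ℝ), (0 : ℝ)) + t • ((0 : ι → ℝ), (1 : ℝ)) := by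
      ext i
      · simp [Prod.fst_sum, Finset.sum_apply, Pi.single_apply]
      · simp [Prod.snd_sum]
    conv_lhs => rw [h1]
    simp only [map_add, map_sum, map_smul, smul_eq_mul]
  set s : ℝ := -φ (0, 1) with hs
  -- The Slater point excludes a vertical hyperplane: if `s = 0`, then `φ` agrees at `(0, T)` and
  -- `(0, v)`, against strict separation.
  have hs0 : 0 < s := by
    have h1 : 0 ≤ s := neg_nonneg.2 (hneg _ ⟨le_rfl, zero_le_one⟩)
    refine h1.lt_of_ne fun h0 => ?_
    have h2 := hφ _ hmem
    rw [hdec, hdec 0 v] at h2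
    have h3 : φ (0, 1) = 0 := by linarith
    simp [h3] at h2
  refine ⟨fun j => -φ (Pi.single j 1, 0) / s, fun j => ?_, fun x hx => ?_⟩
  · refine div_nonneg (neg_nonneg.2 (hneg _ ⟨?_, le_rfl⟩)) hs0.le
    exact Pi.single_nonneg.2 zero_le_one
  · rcases eq_or_ne (f x) ⊤ with htop | htop
    · simp [htop]
    lift f x to ℝ using ⟨htop, hbot x⟩ with r hr
    -- The point `(g x, f x)` is only a limit of points of the strict image.
    have hlim : φ (fun j => g j x, r) ≤ φ (0, v) := by
      have hc : Tendsto (fun ε : ℝ => φ (fun j => g j x + ε, r + ε)) (𝓝[>] 0)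
          (𝓝 (φ (fun j => g j x, r))) := by
        have : Continuous fun ε : ℝ => φ (fun j => g j x + ε, r + ε) := by fun_prop
        simpa using (this.tendsto 0).mono_left nhdsWithin_le_nhds
      refine le_of_tendsto hc ?_
      filter_upwards [self_mem_nhdsWithin] with ε hε
      refine (hφ _ ⟨x, hx, ?_, fun j => lt_add_of_pos_right _ hε⟩).le
      rw [← hr]
      exact EReal.coe_lt_coe_iff.2 (lt_add_of_pos_right _ hε)
    rw [hdec, hdec 0 v] at hlim
    rw [← EReal.coe_add, EReal.coe_le_coe_iff]
    have h4 : ∑ j, -φ (Pi.single j 1, 0) / s * g j x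
        = -(∑ j, g j x * φ (Pi.single j 1, 0)) / s := by
      rw [← Finset.sum_neg_distrib, Finset.sum_div]
      exact Finset.sum_congr rfl fun j _ => by ring
    have h5 : φ (0, 1) = -s := by simp [hs]
    rw [h5] at hlim
    simp only [Pi.zero_apply, zero_mul, Finset.sum_const_zero] at hlim
    rw [h4, ← sub_nonneg]
    have : r + -(∑ j, g j x * φ (Pi.single j 1, 0)) / s - v
        = (r * s - (∑ j, g j x * φ (Pi.single j 1, 0)) - v * s) / s := by
      field_simp
      ring
    rw [this]
    exact div_nonneg (by linarith) hs0.le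

end Duality

/-! ### Homogeneity of the exposure in the radius. -/

section Exposure

variable {p d : ℕ} (unit : EuclideanSpace ℝ (Fin p) → Set (EuclideanSpace ℝ (Fin d)))

open scoped Pointwise in
-- The gauge is positively homogeneous for any set, so the uncertainty sets scale; `sSup` scales
-- too, even at its default values.
lemma exposure_mul (w : EuclideanSpace ℝ (Fin d)) (θ : EuclideanSpace ℝ (Fin p)) {c : ℝ}
    (hc : 0 < c) (ρ : ℝ) : exposure unit w θ (c * ρ) = c * exposure unit w θ ρ := by
  have h : (fun u => inner ℝ w u) '' uncertaintySet unit θ (c * ρ)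
      = c • ((fun u => inner ℝ w u) '' uncertaintySet unit θ ρ) := by
    ext y
    simp only [mem_image, mem_smul_set, uncertaintySet, score, mem_ofPred_eq]
    constructor
    · rintro ⟨u, hu, rfl⟩
      refine ⟨_, ⟨c⁻¹ • u, ?_, rfl⟩, ?_⟩
      · rw [gauge_smul_of_nonneg (inv_nonneg.2 hc.le), smul_eq_mul, inv_mul_le_iff₀ hc]
        exact hu
      · simp [real_inner_smul_right, hc.ne']
    · rintro ⟨_, ⟨u, hu, rfl⟩, rfl⟩
      refine ⟨c • u, ?_, by simp [real_inner_smul_right]⟩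
      rw [gauge_smul_of_nonneg hc.le, smul_eq_mul]
      exact mul_le_mul_of_nonneg_left hu hc.le
  rw [exposure, supportFun, h, Real.sSup_smul_of_nonneg hc.le, smul_eq_mul, exposure, supportFun]

lemma exposure_eq_mul_one (w : EuclideanSpace ℝ (Fin d)) (θ : EuclideanSpace ℝ (Fin p)) {ρ : ℝ}
    (hρ : 0 < ρ) : exposure unit w θ ρ = ρ * exposure unit w θ 1 := by
  simpa using exposure_mul unit w θ hρ 1

variable {unit} in
lemma Dispatch.SupportSmooth.differentiableAt_exposure {n m : ℕ} {D : Dispatch n d m}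
    {Θ : Set (EuclideanSpace ℝ (Fin p))} (h : D.SupportSmooth unit Θ)
    {θ : EuclideanSpace ℝ (Fin p)} (hθ : θ ∈ interior Θ) (j : Fin m) {ρ : ℝ} (hρ : 0 < ρ) :
    DifferentiableAt ℝ (fun θ' => exposure unit (D.w j) θ' ρ) θ :=
  ((h j ρ hρ).differentiableOn one_ne_zero).differentiableAt (isOpen_interior.mem_nhds hθ)

end Exposure

/-! ### The quantile radius and its derivative. -/

section Quantile

variable {p d : ℕ} {unit : EuclideanSpace ℝ (Fin p) → Set (EuclideanSpace ℝ (Fin d))}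
  {P : Measure (EuclideanSpace ℝ (Fin d))} {τ : ℝ} {θ : EuclideanSpace ℝ (Fin p)}

lemma scoreCDF_of_neg (θ : EuclideanSpace ℝ (Fin p)) {r : ℝ} (hr : r < 0) :
    scoreCDF unit P θ r = 0 := by
  have : {u | score unit θ u ≤ r} = ∅ :=
    eq_empty_of_forall_notMem fun u hu => absurd (hu.trans_lt hr) (not_lt.2 (gauge_nonneg u))
  simp [scoreCDF, this]

lemma quantileRadius_nonneg (θ : EuclideanSpace ℝ (Fin p)) : 0 ≤ quantileRadius unit P τ θ :=
  Real.sInf_nonneg fun _ h => h.1.le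

lemma quantileRadius_le {r : ℝ} (hr : 0 < r) (h : τ ≤ scoreCDF unit P θ r) :
    quantileRadius unit P τ θ ≤ r :=
  csInf_le ⟨0, fun _ h => h.1.le⟩ ⟨hr, h⟩

/-- The distribution function vanishes on negative radii, so at radius `0` its left derivative would
be `0`, against the positive density. -/
lemma QuantileRegular.quantileRadius_pos (h : QuantileRegular unit P τ θ) :
    0 < quantileRadius unit P τ θ := by
  refine (quantileRadius_nonneg θ).lt_of_ne fun h0 => ?_
  obtain ⟨h1, h2, -⟩ := h
  rw [← h0] at h1 h2
  have hd := (h1.differentiableAt one_ne_zero).hasDerivAt.hasDerivWithinAt (s := Iio 0)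
  have hF0 : scoreCDF unit P θ 0 = 0 := by
    have ht : Tendsto (scoreCDF unit P θ) (𝓝[<] 0) (𝓝 (scoreCDF unit P θ 0)) :=
      h1.continuousAt.tendsto.mono_left nhdsWithin_le_nhds
    refine tendsto_nhds_unique (ht.congr' ?_) tendsto_const_nhds
    filter_upwards [self_mem_nhdsWithin] with r hr using scoreCDF_of_neg θ hr
  have hc : HasDerivWithinAt (scoreCDF unit P θ) 0 (Iio 0) 0 :=
    (hasDerivWithinAt_const 0 (Iio 0) (0 : ℝ)).congr (fun r hr => scoreCDF_of_neg θ hr) hF0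
  have := (uniqueDiffWithinAt_Iio (0 : ℝ)).eq_deriv _ hd hc
  linarith

variable [IsProbabilityMeasure P]

lemma scoreCDF_mono (θ : EuclideanSpace ℝ (Fin p)) : Monotone (scoreCDF unit P θ) :=
  fun _ _ h => measureReal_mono fun _ hu => le_trans hu h

lemma le_quantileRadius {r s : ℝ} (hr : 0 < r) (h : τ ≤ scoreCDF unit P θ r)
    (hs : scoreCDF unit P θ s < τ) : s ≤ quantileRadius unit P τ θ := by
  refine le_csInf ⟨r, hr, h⟩ fun t ht => ?_
  by_contra! hlt
  exact absurd (ht.2.trans (scoreCDF_mono θ hlt.le)) (not_le.2 hs)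

lemma QuantileRegular.scoreCDF_quantileRadius (h : QuantileRegular unit P τ θ) :
    scoreCDF unit P θ (quantileRadius unit P τ θ) = τ := by
  have hpos := h.quantileRadius_pos
  have hc := h.1.continuousAt.tendsto
  set ρ := quantileRadius unit P τ θ with hρ
  -- An empty set would have `sInf` equal to `0`.
  have hne : {r : ℝ | 0 < r ∧ τ ≤ scoreCDF unit P θ r}.Nonempty := by
    by_contra hempty
    rw [hρ, quantileRadius, not_nonempty_iff_eq_empty.1 hempty, Real.sInf_empty] at hpos
    exact lt_irrefl _ hpos
  apply le_antisymm
  · refine le_of_tendsto (hc.mono_left (nhdsWithin_le_nhds (s := Iio ρ))) ?_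
    filter_upwards [self_mem_nhdsWithin, nhdsWithin_le_nhds (lt_mem_nhds hpos)] with r hr hr0
    by_contra! hlt
    exact absurd (quantileRadius_le hr0 hlt.le) (not_le.2 hr)
  · refine ge_of_tendsto (hc.mono_left (nhdsWithin_le_nhds (s := Ioi ρ))) ?_
    filter_upwards [self_mem_nhdsWithin] with r hr
    obtain ⟨t, ht, htr⟩ := exists_lt_of_csInf_lt hne hr
    exact ht.2.trans (scoreCDF_mono θ htr.le)

/-- Differentiability of the quantile radius. Monotonicity of the distribution function in the radius
replaces the implicit function theorem. -/
lemma QuantileRegular.hasFDerivAt_quantileRadius (h : QuantileRegular unit P τ θ)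
    {A : EuclideanSpace ℝ (Fin p) →L[ℝ] ℝ} {c : ℝ} (hc : 0 < c)
    (hF : HasFDerivAt (fun z : EuclideanSpace ℝ (Fin p) × ℝ => scoreCDF unit P z.1 z.2)
      (A.coprod (c • ContinuousLinearMap.id ℝ ℝ)) (θ, quantileRadius unit P τ θ)) :
    HasFDerivAt (quantileRadius unit P τ) (-(c⁻¹ • A)) θ := by
  have hpos := h.quantileRadius_pos
  have hτ := h.scoreCDF_quantileRadius
  set ρ := quantileRadius unit P τ θ with hρ
  set L : EuclideanSpace ℝ (Fin p) →L[ℝ] ℝ := -(c⁻¹ • A) with hL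
  have hAL : ∀ x, A x = -(c * L x) := fun x => by simp [hL, hc.ne']
  -- `L` solves `A + c L = 0`, so along this perturbed radius the first-order change of the
  -- distribution function is only `c * κ * ‖θ' - θ‖`.
  have expand : ∀ κ : ℝ, ∀ η > 0, ∀ᶠ θ' in 𝓝 θ,
      |scoreCDF unit P θ' (ρ + L (θ' - θ) + κ * ‖θ' - θ‖) - τ - c * κ * ‖θ' - θ‖|
        ≤ η * ‖θ' - θ‖ := by
    intro κ η hη
    have hcont : Tendsto (fun θ' => (θ', ρ + L (θ' - θ) + κ * ‖θ' - θ‖)) (𝓝 θ) (𝓝 (θ, ρ)) := by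
      have : Continuous fun θ' => (θ', ρ + L (θ' - θ) + κ * ‖θ' - θ‖) := by fun_prop
      simpa using this.tendsto θ
    -- `K` bounds the displacement in the product space relative to `‖θ' - θ‖`.
    set K : ℝ := 1 + ‖L‖ + |κ| with hK
    have hKpos : 0 < K := by positivity
    have h1 := hcont.eventually (hF.isLittleO.def (div_pos hη hKpos))
    filter_upwards [h1] with θ' h2
    have h3 : ‖((θ', ρ + L (θ' - θ) + κ * ‖θ' - θ‖) : EuclideanSpace ℝ (Fin p) × ℝ) - (θ, ρ)‖
        ≤ K * ‖θ' - θ‖ := by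
      rw [Prod.mk_sub_mk, Prod.norm_mk]
      have h4 : ‖L (θ' - θ)‖ ≤ ‖L‖ * ‖θ' - θ‖ := L.le_opNorm _
      have h5 := norm_nonneg (θ' - θ)
      have h6 := norm_nonneg L
      have h7 := abs_nonneg κ
      refine max_le (by nlinarith) ?_
      have h8 : ρ + L (θ' - θ) + κ * ‖θ' - θ‖ - ρ = L (θ' - θ) + κ * ‖θ' - θ‖ := by ring
      rw [h8]
      refine (norm_add_le _ _).trans ?_
      rw [norm_mul, norm_norm, Real.norm_eq_abs κ]
      nlinarith
    have h9 := h2.trans (mul_le_mul_of_nonneg_left h3 (div_pos hη hKpos).le)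
    rw [← mul_assoc, div_mul_cancel₀ _ hKpos.ne', Real.norm_eq_abs] at h9
    refine (le_of_eq (congrArg abs ?_)).trans h9
    simp only [Prod.mk_sub_mk, ContinuousLinearMap.coprod_apply, hAL, hτ,
      smul_apply, ContinuousLinearMap.id_apply, smul_eq_mul]
    ring
  rw [hasFDerivAt_iff_isLittleO, Asymptotics.isLittleO_iff]
  intro ε hε
  have hcε : 0 < c * ε / 2 := by positivity
  have hposev : ∀ᶠ θ' in 𝓝 θ, 0 < ρ + L (θ' - θ) + ε * ‖θ' - θ‖ := by
    have : Continuous fun θ' => ρ + L (θ' - θ) + ε * ‖θ' - θ‖ := by fun_prop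
    exact this.tendsto θ |>.eventually (lt_mem_nhds (by simpa using hpos))
  -- For `κ = ±ε` the error `c * ε / 2` is half the main term, so the two radii lie on opposite
  -- sides of level `τ` and enclose the quantile.
  filter_upwards [expand ε _ hcε, expand (-ε) _ hcε, hposev] with θ' h1 h2 h3
  rcases eq_or_ne θ' θ with rfl | hne
  · simp [← hρ]
  have hn : 0 < ‖θ' - θ‖ := norm_pos_iff.2 (sub_ne_zero.2 hne)
  have hprod : 0 < c * ε * ‖θ' - θ‖ := by positivity
  rw [abs_le] at h1 h2
  have hup : τ ≤ scoreCDF unit P θ' (ρ + L (θ' - θ) + ε * ‖θ' - θ‖) := by linarith [h1.1]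
  have hlo : scoreCDF unit P θ' (ρ + L (θ' - θ) + -ε * ‖θ' - θ‖) < τ := by linarith [h2.2]
  rw [Real.norm_eq_abs, abs_le, ← hρ]
  constructor
  · linarith [le_quantileRadius h3 hup hlo]
  · linarith [quantileRadius_le h3 hup]

lemma QuantileRegular.hasGradientAt_quantileRadius (h : QuantileRegular unit P τ θ) :
    HasGradientAt (quantileRadius unit P τ)
      (-((deriv (scoreCDF unit P θ) (quantileRadius unit P τ θ))⁻¹ •
        gradient (fun θ' => scoreCDF unit P θ' (quantileRadius unit P τ θ)) θ)) θ := by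
  have hF := (h.2.2.differentiableAt one_ne_zero).hasFDerivAt
  set ρ := quantileRadius unit P τ θ with hρ
  set B := fderiv ℝ (fun z : EuclideanSpace ℝ (Fin p) × ℝ => scoreCDF unit P z.1 z.2) (θ, ρ)
  have h1 : HasFDerivAt (fun θ' => scoreCDF unit P θ' ρ)
      (B.comp (ContinuousLinearMap.inl ℝ (EuclideanSpace ℝ (Fin p)) ℝ)) θ :=
    HasFDerivAt.comp (f := fun θ' => (θ', ρ)) θ hF (hasFDerivAt_prodMk_left θ ρ)
  have h2 : HasFDerivAt (scoreCDF unit P θ)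
      (B.comp (ContinuousLinearMap.inr ℝ (EuclideanSpace ℝ (Fin p)) ℝ)) ρ :=
    HasFDerivAt.comp (f := fun r => (θ, r)) ρ hF (hasFDerivAt_prodMk_right θ ρ)
  have hB : B = (B.comp (ContinuousLinearMap.inl ℝ (EuclideanSpace ℝ (Fin p)) ℝ)).coprod
      (deriv (scoreCDF unit P θ) ρ • ContinuousLinearMap.id ℝ ℝ) := by
    rw [h2.hasDerivAt.deriv]
    ext x
    · simp
    · simp
  rw [hB] at hF
  rw [hasGradientAt_iff_hasFDerivAt, h1.hasGradientAt.gradient]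
  exact (h.hasFDerivAt_quantileRadius h.2.1 hF).congr_fderiv (by simp [ρ])

end Quantile

/-! ### Weak and strong duality for the dispatch problem. -/

namespace Dispatch

variable {n p d m : ℕ} {D : Dispatch n d m}
  {unit : EuclideanSpace ℝ (Fin p) → Set (EuclideanSpace ℝ (Fin d))}
  {θ θ' : EuclideanSpace ℝ (Fin p)} {ρ ρ' : ℝ}

lemma Slater.value_ne_bot (h : D.Slater unit θ ρ) (θ' : EuclideanSpace ℝ (Fin p)) (ρ' : ℝ) :
    D.value unit θ' ρ' ≠ ⊥ := by
  obtain ⟨-, ⟨c, hc⟩, -⟩ := h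
  refine ne_bot_of_le_ne_bot (EReal.coe_ne_bot c) (le_iInf₂ fun x hx => hc x hx.1)

/-- Strict feasibility of the Slater point persists along convergent exposures. -/
lemma Slater.eventually_value_ne_top (h : D.Slater unit θ ρ) {α : Type*} {l : Filter α}
    {t : α → EuclideanSpace ℝ (Fin p)} {r : α → ℝ}
    (hlim : ∀ j, Tendsto (fun i => exposure unit (D.w j) (t i) (r i)) l
      (𝓝 (exposure unit (D.w j) θ ρ))) :
    ∀ᶠ i in l, D.value unit (t i) (r i) ≠ ⊤ := by
  obtain ⟨-, -, x, hx, hfx, hgx⟩ := h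
  have hev : ∀ᶠ i in l, ∀ j, D.a j x + exposure unit (D.w j) (t i) (r i) < D.b j :=
    eventually_all.2 fun j => ((hlim j).const_add _).eventually (gt_mem_nhds (hgx j))
  filter_upwards [hev] with i hi
  exact ((iInf₂_le x ⟨intrinsicInterior_subset hx, fun j => (hi j).le⟩).trans_lt hfx).ne

/-- Weak duality. -/
lemma dualFun_le_value {μ : Fin m → ℝ} (hμ : 0 ≤ μ) :
    D.dualFun unit θ ρ μ ≤ D.value unit θ ρ := by
  refine le_iInf₂ fun x hx => (iInf₂_le x hx.1).trans ?_
  have h : ∑ j, μ j * (D.a j x + exposure unit (D.w j) θ ρ - D.b j) ≤ 0 :=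
    Finset.sum_nonpos fun j _ => mul_nonpos_of_nonneg_of_nonpos (hμ j) (sub_nonpos.2 (hx.2 j))
  calc D.f x + ((∑ j, μ j * (D.a j x + exposure unit (D.w j) θ ρ - D.b j) : ℝ) : EReal)
      ≤ D.f x + ((0 : ℝ) : EReal) := by gcongr
    _ = D.f x := by simp

/-- Strong duality with attainment under the Slater condition. -/
lemma Slater.exists_value_le_dualFun (h : D.Slater unit θ ρ) :
    ∃ μ : Fin m → ℝ, 0 ≤ μ ∧ D.value unit θ ρ ≤ D.dualFun unit θ ρ μ := by
  have hbot := h.value_ne_bot θ ρ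
  obtain ⟨htop, -, x, hx, hfx, hgx⟩ := h
  have hv := EReal.coe_toReal htop.ne hbot
  obtain ⟨μ, hμ, hle⟩ := exists_multiplier (v := (D.value unit θ ρ).toReal)
    (g := fun j x => D.a j x + exposure unit (D.w j) θ ρ - D.b j)
    D.convex_X D.f_ne_bot D.convex_f
    (fun j => by
      simp only [add_sub_assoc]
      exact (D.convex_a j).add_const (exposure unit (D.w j) θ ρ - D.b j))
    (fun y hy hyg => by
      rw [hv]
      exact iInf₂_le y ⟨hy, fun j => sub_nonpos.1 (hyg j)⟩)
    ⟨x, intrinsicInterior_subset hx, hfx, fun j => sub_neg.2 (hgx j)⟩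
  rw [hv] at hle
  exact ⟨μ, hμ, le_iInf₂ hle⟩

lemma Slater.dualOptimizers_nonempty (h : D.Slater unit θ ρ) :
    (D.dualOptimizers unit θ ρ).Nonempty := by
  obtain ⟨μ, hμ, hle⟩ := h.exists_value_le_dualFun
  exact ⟨μ, hμ, fun ν hν => (dualFun_le_value hν).trans hle⟩

lemma Slater.value_le_dualFun (h : D.Slater unit θ ρ) {μ : Fin m → ℝ}
    (hμ : μ ∈ D.dualOptimizers unit θ ρ) : D.value unit θ ρ ≤ D.dualFun unit θ ρ μ := by
  obtain ⟨ν, hν, hle⟩ := h.exists_value_le_dualFun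
  exact hle.trans (hμ.2 ν hν)

/-- Changing the parameters shifts the Lagrangian by a constant independent of `x`. -/
lemma dualFun_add_le_dualFun (μ : Fin m → ℝ) :
    D.dualFun unit θ ρ μ + ((∑ j, μ j * (exposure unit (D.w j) θ' ρ'
      - exposure unit (D.w j) θ ρ) : ℝ) : EReal) ≤ D.dualFun unit θ' ρ' μ := by
  refine le_iInf₂ fun x hx => ?_
  have h : ∑ j, μ j * (D.a j x + exposure unit (D.w j) θ' ρ' - D.b j)
      = ∑ j, μ j * (D.a j x + exposure unit (D.w j) θ ρ - D.b j)
        + ∑ j, μ j * (exposure unit (D.w j) θ' ρ' - exposure unit (D.w j) θ ρ) := by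
    rw [← Finset.sum_add_distrib]
    exact Finset.sum_congr rfl fun j _ => by ring
  rw [h, EReal.coe_add, ← add_assoc]
  gcongr
  exact iInf₂_le x hx

/-- Optimal multipliers give a global lower bound on the value function. -/
lemma Slater.toReal_value_add_le (h : D.Slater unit θ ρ) {μ : Fin m → ℝ}
    (hμ : μ ∈ D.dualOptimizers unit θ ρ) (htop : D.value unit θ' ρ' ≠ ⊤) :
    (D.value unit θ ρ).toReal + ∑ j, μ j * (exposure unit (D.w j) θ' ρ'
      - exposure unit (D.w j) θ ρ) ≤ (D.value unit θ' ρ').toReal := by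
  rw [← EReal.coe_le_coe_iff, EReal.coe_add, EReal.coe_toReal h.1.ne (h.value_ne_bot _ _),
    EReal.coe_toReal htop (h.value_ne_bot _ _)]
  calc _ ≤ D.dualFun unit θ ρ μ + ((∑ j, μ j * (exposure unit (D.w j) θ' ρ'
          - exposure unit (D.w j) θ ρ) : ℝ) : EReal) := by gcongr; exact h.value_le_dualFun hμ
    _ ≤ D.dualFun unit θ' ρ' μ := dualFun_add_le_dualFun μ
    _ ≤ D.value unit θ' ρ' := dualFun_le_value hμ.1

end Dispatch

/-- The gradient of the exposure along a differentiable radius. -/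
lemma hasGradientAt_exposure_comp {p d : ℕ}
    {unit : EuclideanSpace ℝ (Fin p) → Set (EuclideanSpace ℝ (Fin d))}
    {w : EuclideanSpace ℝ (Fin d)} {θ : EuclideanSpace ℝ (Fin p)}
    {r : EuclideanSpace ℝ (Fin p) → ℝ} (hpos : 0 < r θ) (hr : DifferentiableAt ℝ r θ)
    (hσ : DifferentiableAt ℝ (fun θ' => exposure unit w θ' (r θ)) θ) :
    HasGradientAt (fun θ' => exposure unit w θ' (r θ'))
      (gradient (fun θ' => exposure unit w θ' (r θ)) θ + exposure unit w θ 1 • gradient r θ) θ := by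
  have hmul := ((hr.hasFDerivAt.const_mul (r θ)⁻¹).mul hσ.hasFDerivAt)
  -- Homogeneity moves the varying radius into a scalar factor, so smoothness at the fixed radius `r
  -- θ` and the product rule suffice.
  have hev : (fun θ' => exposure unit w θ' (r θ')) =ᶠ[𝓝 θ]
      fun θ' => ((r θ)⁻¹ * r θ') * exposure unit w θ' (r θ) := by
    filter_upwards [hr.continuousAt.eventually (lt_mem_nhds hpos)] with θ' h
    rw [exposure_eq_mul_one unit w θ' h, exposure_eq_mul_one unit w θ' hpos]
    field_simp
  rw [hasGradientAt_iff_hasFDerivAt]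
  refine (hmul.congr_of_eventuallyEq hev).congr_fderiv ?_
  rw [exposure_eq_mul_one unit w θ hpos]
  ext x
  simp [gradient, hpos.ne']
  field_simp

end RobustProfile

theorem mainTheorem4 {n p d m : ℕ}
    (unit : EuclideanSpace ℝ (Fin p) → Set (EuclideanSpace ℝ (Fin d)))
    (Θ : Set (EuclideanSpace ℝ (Fin p)))
    (D : RobustProfile.Dispatch n d m)
    (P : Measure (EuclideanSpace ℝ (Fin d))) [IsProbabilityMeasure P]
    (τ : ℝ) (hτ : τ ∈ Set.Ioo (0 : ℝ) 1)
    (θ : EuclideanSpace ℝ (Fin p)) (hθ : θ ∈ interior Θ)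
    (hgauge : RobustProfile.GaugeRegular unit Θ)
    (hslater : D.Slater unit θ (RobustProfile.quantileRadius unit P τ θ))
    (hsupport : D.SupportSmooth unit Θ)
    (hquantile : RobustProfile.QuantileRegular unit P τ θ)
    (hV : DifferentiableAt ℝ
      (fun z : EuclideanSpace ℝ (Fin p) × ℝ => (D.value unit z.1 z.2).toReal)
      (θ, RobustProfile.quantileRadius unit P τ θ)) :
    -- the profiled objective is finite near `θ`, so its real value is meaningful there
    (∀ᶠ θ' in 𝓝 θ, RobustProfile.profiled D unit P τ θ' ≠ ⊤ ∧
      RobustProfile.profiled D unit P τ θ' ≠ ⊥) ∧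
    -- the gradient of the quantile radius
    HasGradientAt (RobustProfile.quantileRadius unit P τ)
      (-((deriv (RobustProfile.scoreCDF unit P θ) (RobustProfile.quantileRadius unit P τ θ))⁻¹ •
        gradient (fun θ' =>
          RobustProfile.scoreCDF unit P θ' (RobustProfile.quantileRadius unit P τ θ)) θ)) θ ∧
    -- the gradient of the profiled objective
    (D.dualOptimizers unit θ (RobustProfile.quantileRadius unit P τ θ)).Nonempty ∧
    ∀ μ ∈ D.dualOptimizers unit θ (RobustProfile.quantileRadius unit P τ θ),
      HasGradientAt (fun θ' => (RobustProfile.profiled D unit P τ θ').toReal)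
        (D.shapeGrad unit θ (RobustProfile.quantileRadius unit P τ θ) μ +
          D.radiusGrad unit θ μ • gradient (RobustProfile.quantileRadius unit P τ) θ) θ := by
  have hpos := hquantile.quantileRadius_pos
  have hgrad := hquantile.hasGradientAt_quantileRadius
  have hdiff := hgrad.differentiableAt
  have hσ := fun j => RobustProfile.hasGradientAt_exposure_comp hpos hdiff
    (hsupport.differentiableAt_exposure hθ j hpos)
  -- Finiteness matters for `toReal`, which sends `⊤` to `0` and would break the lower bound.
  have hfin := hslater.eventually_value_ne_top (l := 𝓝 θ) (t := id)
    (r := RobustProfile.quantileRadius unit P τ) fun j => (hσ j).continuousAt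
  refine ⟨hfin.mono fun θ' h => ⟨h, hslater.value_ne_bot _ _⟩, hgrad,
    hslater.dualOptimizers_nonempty, fun μ hμ => ?_⟩
  have hJ : DifferentiableAt ℝ (fun θ' => (RobustProfile.profiled D unit P τ θ').toReal) θ :=
    DifferentiableAt.comp (f := fun θ' => (θ', RobustProfile.quantileRadius unit P τ θ')) θ hV
      (differentiableAt_id.prodMk hdiff)
  have hS : HasFDerivAt (fun θ' => ∑ j, μ j * RobustProfile.exposure unit (D.w j) θ'
      (RobustProfile.quantileRadius unit P τ θ')) _ θ :=
    HasFDerivAt.fun_sum fun j _ => (hσ j).hasFDerivAt.const_mul (μ j)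
  -- The multiplier bound, restricted to the curve `ρ' = ρ_P(θ')`.
  have hmin : IsLocalMin (fun θ' => (RobustProfile.profiled D unit P τ θ').toReal
      - ∑ j, μ j * RobustProfile.exposure unit (D.w j) θ'
        (RobustProfile.quantileRadius unit P τ θ')) θ := by
    filter_upwards [hfin] with θ' h
    have := hslater.toReal_value_add_le hμ h
    simp only [mul_sub, Finset.sum_sub_distrib, id_eq] at this
    simp only [RobustProfile.profiled]
    linarith
  have hzero := hmin.hasFDerivAt_eq_zero (hJ.hasFDerivAt.sub hS)
  rw [hasGradientAt_iff_hasFDerivAt]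
  refine hJ.hasFDerivAt.congr_fderiv ((sub_eq_zero.1 hzero).trans ?_)
  simp only [RobustProfile.Dispatch.shapeGrad, RobustProfile.Dispatch.radiusGrad, map_add,
    map_sum, map_smul, Finset.sum_smul, smul_add, Finset.sum_add_distrib, mul_smul]
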